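/- **Conventions.** For a real square matrix $A$, $\sigma(A)$ denotes its spectrum, i.e. the list (taken up to order) of its complex eigenvalues counted with algebraic multiplicity. A list of complex numbers is *realisable* if it is the spectrum of some entrywise nonnegative real square matrix. The *Perron eigenvalue* of a realisable list is its entry $\rho$ equal to the maximum of the moduli of its entries. Inequalities between real vectors or matrices are entrywise. **Lemma.** Let $m,n\ge 2$ be integers and let the following assumptions hold: (i) the list $(\rho,\lambda_2,\lambda_3,\ldots,\lambda_m)$ of complex numbers is realisable, where $\rho$ is its Perron eigenvalue, $\lambda_2$ is real and $\rho\neq\lambda_2$; (ii) $C'=\begin{bmatrix}\gamma&1\\ b_2&b_1+\gamma\end{bmatrix}$, where $b_1$ is real, $\gamma=(\rho+\lambda_2-b_1)/2\ge 0$ and $b_2=\left((\rho-\lambda_2)^2-b_1^2\right)/4$; (iii) $K'=\begin{bmatrix}f&g\end{bmatrix}$, where $f,g\in\mathbb{R}^{n-2}$, $g\ge 0$ and $f\ge(\gamma-\lambda_2)g$; (iv) $L'=\begin{bmatrix}c^T\\ d^T\end{bmatrix}$, where $c,d\in\mathbb{R}^{n-2}$, $c\ge 0$ and $d\ge(\rho-\gamma)c$;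 (v) $A$ is an $(n-2)\times(n-2)$ real matrix with $A\ge 0$; (vi) $M'$ is the $n\times n$ matrix $M'=\begin{bmatrix}A&K'\\ L'&C'\end{bmatrix}$. Then the list $(\sigma(M'),\lambda_3,\lambda_4,\ldots,\lambda_m)$ is realisable. -/

import Mathlib

/-- The spectrum of a real square matrix: the multiset of the complex roots of its characteristic
polynomial, counted with algebraic multiplicity. -/
noncomputable def spec {ι : Type*} [Fintype ι] [DecidableEq ι] (A : Matrix ι ι ℝ) : Multiset ℂ :=
  (A.map (fun x : ℝ => (x : ℂ))).charpoly.roots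

/-- A list of complex numbers (taken up to order) is realisable if it is the spectrum of an
entrywise nonnegative real square matrix. -/
def Realisable (σ : Multiset ℂ) : Prop :=
  ∃ (N : ℕ) (B : Matrix (Fin N) (Fin N) ℝ), (∀ i j, 0 ≤ B i j) ∧ spec B = σ

/-- `ρ` is the Perron eigenvalue of the list `σ`: it belongs to `σ` and equals the maximum of the
moduli of the entries of `σ`. -/
def IsPerronEigenvalue (ρ : ℝ) (σ : Multiset ℂ) : Prop :=
  (ρ : ℂ) ∈ σ ∧ ∀ μ ∈ σ, ‖μ‖ ≤ ρ

open Matrix Polynomial Topology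

/-! ### Bordered matrices with intertwined blocks -/

section Intertwining

variable {l m n : Type*} [Fintype l] [DecidableEq l] [Fintype m] [DecidableEq m]
  [Fintype n] [DecidableEq n]

/-! Realise the given list by `B ≥ 0` with all row sums `ρ`, and let `y` be a `lam₂`-eigenvector
with maximum `1` and some entry `≤ 0`. The span of the all-ones vector and `y` is `B`-invariant, so
some `U` satisfies `B * U = U * C'`. If `K * U = K'`, the Schur complements of `M = [A, K; U * L',
B]` and `M'` agree, and cancelling `spec C' = {ρ, lam₂}` leaves `spec M = spec M' + tail`. The
bounds on `f` and `d` are what allow `K ≥ 0` and `U * L' ≥ 0`.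

Constant row sums come from conjugating a positive matrix by its Perron vector, then passing to a
limit by compactness. -/

theorem scalar_sub_fromBlocks {R : Type*} [CommRing R] (t : R) (A : Matrix l l R)
    (P : Matrix l m R) (Q : Matrix m l R) (D : Matrix m m R) :
    scalar (l ⊕ m) t - fromBlocks A P Q D =
      fromBlocks (scalar l t - A) (-P) (-Q) (scalar m t - D) := by
  ext (i | i) (j | j) <;> simp [Matrix.diagonal_apply]

/-- If `B * U = U * C`, the bordered matrices `[A, K; U * L, B]` and `[A, K * U; L, C]` have
characteristic polynomials in the same ratio as those of `B` and `C`. -/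
theorem charpoly_fromBlocks_mul_charpoly_of_intertwine {F : Type*} [Field F] [Infinite F]
    (A : Matrix l l F) (K : Matrix l m F) (L : Matrix n l F) (B : Matrix m m F)
    (C : Matrix n n F) (U : Matrix m n F) (h : B * U = U * C) :
    (fromBlocks A K (U * L) B).charpoly * C.charpoly =
      (fromBlocks A (K * U) L C).charpoly * B.charpoly := by
  have hne : B.charpoly * C.charpoly ≠ 0 :=
    mul_ne_zero B.charpoly_monic.ne_zero C.charpoly_monic.ne_zero
  -- The extra factor makes the identity trivial at every `t` where a resolvent fails to exist.
  refine mul_right_cancel₀ hne (Polynomial.funext fun t => ?_)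
  by_cases hB : (scalar m t - B).det = 0
  · simp [eval_mul, (Matrix.eval_charpoly B t).trans hB]
  by_cases hC : (scalar n t - C).det = 0
  · simp [eval_mul, (Matrix.eval_charpoly C t).trans hC]
  have hBU : IsUnit (scalar m t - B).det := isUnit_iff_ne_zero.mpr hB
  have hCU : IsUnit (scalar n t - C).det := isUnit_iff_ne_zero.mpr hC
  let _ := (scalar m t - B).invertibleOfIsUnitDet hBU
  let _ := (scalar n t - C).invertibleOfIsUnitDet hCU
  have hcomm : (scalar m t - B) * U = U * (scalar n t - C) := by
    rw [Matrix.sub_mul, Matrix.mul_sub, h]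
    congr 1
    ext i j
    simp [mul_comm]
  have hinv : ⅟(scalar m t - B) * U = U * ⅟(scalar n t - C) := by
    calc ⅟(scalar m t - B) * U
        = ⅟(scalar m t - B) * (U * (scalar n t - C)) * ⅟(scalar n t - C) := by
          rw [Matrix.mul_assoc, Matrix.mul_assoc, mul_invOf_self, Matrix.mul_one]
      _ = U * ⅟(scalar n t - C) := by
          rw [← hcomm, ← Matrix.mul_assoc, invOf_mul_self, Matrix.one_mul]
  have hS : K * ⅟(scalar m t - B) * (U * L) = K * U * ⅟(scalar n t - C) * L := by
    rw [← Matrix.mul_assoc, Matrix.mul_assoc K, hinv, ← Matrix.mul_assoc]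
  simp only [eval_mul, Matrix.eval_charpoly, scalar_sub_fromBlocks, det_fromBlocks₂₂, Matrix.neg_mul,
    Matrix.mul_neg, neg_neg, hS]
  ring

end Intertwining

/-! ### Perron vectors and constant row sums -/

section Perron

variable {n : Type*} [Fintype n]

/-- A positive matrix has a positive eigenvector. -/
theorem exists_pos_eigenvector_of_pos [Nonempty n] (A : Matrix n n ℝ) (hA : ∀ i j, 0 < A i j) :
    ∃ (r : ℝ) (x : n → ℝ), (∀ i, 0 < x i) ∧ A *ᵥ x = r • x := by
  classical
  set T : ℝ := ∑ i, ∑ j, A i j with hT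
  have hT0 : 0 ≤ T := Finset.sum_nonneg fun i _ => Finset.sum_nonneg fun j _ => (hA i j).le
  have hpos : ∀ z : n → ℝ, (∀ i, 0 ≤ z i) → z ≠ 0 → ∀ i, 0 < (A *ᵥ z) i := by
    intro z hz hz0 i
    obtain ⟨j, hj⟩ := Function.ne_iff.mp hz0
    exact Finset.sum_pos' (fun j _ => mul_nonneg (hA i j).le (hz j))
      ⟨j, Finset.mem_univ j, mul_pos (hA i j) (lt_of_le_of_ne (hz j) (Ne.symm hj))⟩
  have hbound : ∀ (t : ℝ) (x : n → ℝ), x ∈ stdSimplex ℝ n → (∀ i, t * x i ≤ (A *ᵥ x) i) →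
      t ≤ T := by
    intro t x hx h
    calc t = ∑ i, t * x i := by rw [← Finset.mul_sum, hx.2, mul_one]
      _ ≤ ∑ i, (A *ᵥ x) i := Finset.sum_le_sum fun i _ => h i
      _ ≤ T := Finset.sum_le_sum fun i _ => Finset.sum_le_sum fun j _ =>
          mul_le_of_le_one_right (hA i j).le
            (hx.2 ▸ Finset.single_le_sum (fun k _ => hx.1 k) (Finset.mem_univ j))
  -- Collatz–Wielandt: maximise `t` subject to `t x ≤ A x` over the simplex.
  let S : Set (ℝ × (n → ℝ)) :=
    (Set.Icc 0 T ×ˢ stdSimplex ℝ n) ∩ {p | ∀ i, p.1 * p.2 i ≤ (A *ᵥ p.2) i}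
  have hScomp : IsCompact S := by
    refine (isCompact_Icc.prod (isCompact_stdSimplex ℝ n)).inter_right ?_
    simp only [Set.ofPred_forall]
    exact isClosed_iInter fun i => isClosed_le (by fun_prop)
      ((continuous_apply i).comp (continuous_const.matrix_mulVec continuous_snd))
  have hSne : S.Nonempty := by
    obtain ⟨i⟩ := ‹Nonempty n›
    refine ⟨(0, Pi.single i 1), ⟨⟨⟨le_rfl, hT0⟩, single_mem_stdSimplex ℝ i⟩, fun j => ?_⟩⟩
    simpa using (hA j i).le
  obtain ⟨⟨t, x⟩, ⟨⟨ht, hx⟩, hle⟩, hmax⟩ := hScomp.exists_isMaxOn hSne continuous_fst.continuousOn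
  simp only at ht hx hle
  simp only [Set.mem_ofPred_eq] at hle
  have hx0 : x ≠ 0 := by
    rintro rfl
    simpa using hx.2
  have hy := hpos x hx.1 hx0
  have hz0 : A *ᵥ x - t • x = 0 := by
    -- Positivity of `A` turns nonzero slack `A x - t x` into strict slack at `y = A x` in every
    -- coordinate, so `t` could be increased by the least ratio `ε`.
    by_contra hz
    set y := A *ᵥ x with hydef
    have hw := hpos (y - t • x) (fun i => sub_nonneg.mpr (hle i)) hz
    obtain ⟨i₀, -, hi₀⟩ := Finset.exists_min_image Finset.univ
      (fun i => (A *ᵥ (y - t • x)) i / y i) Finset.univ_nonempty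
    set ε := (A *ᵥ (y - t • x)) i₀ / y i₀
    have hε : 0 < ε := div_pos (hw i₀) (hy i₀)
    have hs : 0 < ∑ i, y i := Finset.sum_pos (fun i _ => hy i) Finset.univ_nonempty
    have hy' : (∑ i, y i)⁻¹ • y ∈ stdSimplex ℝ n :=
      ⟨fun i => mul_nonneg (inv_nonneg.mpr hs.le) (hy i).le, by
        simp [← Finset.mul_sum, hs.ne']⟩
    have hle' : ∀ i, (t + ε) * ((∑ i, y i)⁻¹ • y) i ≤ (A *ᵥ ((∑ i, y i)⁻¹ • y)) i := by
      intro i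
      have h1 := (le_div_iff₀ (hy i)).mp (hi₀ i (Finset.mem_univ i))
      rw [mulVec_sub, mulVec_smul, ← hydef] at h1
      simp only [Pi.sub_apply, Pi.smul_apply, smul_eq_mul] at h1
      rw [mulVec_smul]
      simp only [Pi.smul_apply, smul_eq_mul]
      rw [mul_left_comm]
      exact mul_le_mul_of_nonneg_left (by linarith) (inv_nonneg.mpr hs.le)
    have := hmax (show ((t + ε), (∑ i, y i)⁻¹ • y) ∈ S from
      ⟨⟨⟨by linarith [ht.1], hbound _ _ hy' hle'⟩, hy'⟩, hle'⟩)
    simp only [Set.mem_ofPred_eq] at this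
    linarith
  have hAx : A *ᵥ x = t • x := sub_eq_zero.mp hz0
  refine ⟨t, x, fun i => ?_, hAx⟩
  have h1 := hy i
  rw [hAx, Pi.smul_apply, smul_eq_mul] at h1
  exact pos_of_mul_pos_right h1 ht.1

/-- An eigenvalue of a nonnegative matrix is at most any common value of its row sums. -/
theorem eigenvalue_le_row_sum {B : Matrix n n ℝ} {r s : ℝ} (hB : ∀ i j, 0 ≤ B i j)
    (hr : ∀ i, ∑ j, B i j = r) {v : n → ℝ} (hv : v ≠ 0) (h : B *ᵥ v = s • v) : s ≤ r := by
  obtain ⟨j, hj⟩ := Function.ne_iff.mp hv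
  obtain ⟨i, -, hi⟩ := Finset.exists_max_image Finset.univ (fun i => |v i|) ⟨j, Finset.mem_univ j⟩
  have hi0 : 0 < |v i| := (abs_pos.mpr hj).trans_le (hi j (Finset.mem_univ j))
  refine le_of_mul_le_mul_right ?_ hi0
  calc s * |v i| ≤ |s * v i| := by
        rw [abs_mul]; exact mul_le_mul_of_nonneg_right (le_abs_self s) hi0.le
    _ = |∑ k, B i k * v k| := congrArg abs (congrFun h i).symm
    _ ≤ ∑ k, |B i k * v k| := Finset.abs_sum_le_sum_abs _ _
    _ ≤ ∑ k, B i k * |v i| := Finset.sum_le_sum fun k _ => by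
        rw [abs_mul, abs_of_nonneg (hB i k)]
        exact mul_le_mul_of_nonneg_left (hi k (Finset.mem_univ k)) (hB i k)
    _ = r * |v i| := by rw [← Finset.sum_mul, hr i]

/-- An eigenvector of a nonnegative matrix with constant row sums `r`, for an eigenvalue below
`r`, has a nonpositive entry. -/
theorem exists_nonpos_of_eigenvalue_lt_row_sum [Nonempty n] {B : Matrix n n ℝ} {r s : ℝ}
    (hB : ∀ i j, 0 ≤ B i j) (hr : ∀ i, ∑ j, B i j = r) (hs : s < r) {v : n → ℝ}
    (h : B *ᵥ v = s • v) : ∃ i, v i ≤ 0 := by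
  by_contra! hv
  obtain ⟨i, -, hi⟩ := Finset.exists_min_image Finset.univ v Finset.univ_nonempty
  have h1 : s * v i = ∑ k, B i k * v k := (congrFun h i).symm
  have h2 : r * v i ≤ ∑ k, B i k * v k := by
    rw [← hr i, Finset.sum_mul]
    exact Finset.sum_le_sum fun k _ => mul_le_mul_of_nonneg_left (hi k (Finset.mem_univ k)) (hB i k)
  nlinarith [hv i]

/-- An eigenvector of a nonnegative matrix with constant row sums `r`, for an eigenvalue below
`r`, can be scaled to have maximal entry `1`, and it then has a nonpositive entry. -/
theorem exists_normalized_eigenvector [Nonempty n] {B : Matrix n n ℝ} {r s : ℝ}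
    (hB : ∀ i j, 0 ≤ B i j) (hr : ∀ i, ∑ j, B i j = r) (hs : s < r) {v : n → ℝ} (hv : v ≠ 0)
    (h : B *ᵥ v = s • v) :
    ∃ y : n → ℝ, B *ᵥ y = s • y ∧ (∀ i, y i ≤ 1) ∧ (∃ p, y p = 1) ∧ ∃ q, y q ≤ 0 := by
  wlog hpos : ∃ i, 0 < v i generalizing v
  · refine this (v := -v) (neg_ne_zero.mpr hv) (by rw [mulVec_neg, h, smul_neg]) ?_
    obtain ⟨i, hi⟩ := Function.ne_iff.mp hv
    push Not at hpos
    exact ⟨i, neg_pos.mpr (lt_of_le_of_ne (hpos i) hi)⟩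
  obtain ⟨i, hi⟩ := hpos
  obtain ⟨p, -, hp⟩ := Finset.exists_max_image Finset.univ v Finset.univ_nonempty
  have hp0 : 0 < v p := hi.trans_le (hp i (Finset.mem_univ i))
  have hy : B *ᵥ ((v p)⁻¹ • v) = s • (v p)⁻¹ • v := by rw [mulVec_smul, h, smul_comm]
  refine ⟨(v p)⁻¹ • v, hy, fun j => ?_, ⟨p, ?_⟩, exists_nonpos_of_eigenvalue_lt_row_sum hB hr hs hy⟩
  · rw [Pi.smul_apply, smul_eq_mul, inv_mul_le_iff₀ hp0, mul_one]
    exact hp j (Finset.mem_univ j)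
  · simp [hp0.ne']

variable [DecidableEq n]

/-- A positive matrix has the characteristic polynomial of a nonnegative matrix with constant row
sums, which are at most the sum of all entries of the original matrix. -/
theorem exists_constant_row_sums_of_pos [Nonempty n] (A : Matrix n n ℝ) (hA : ∀ i j, 0 < A i j) :
    ∃ (r : ℝ) (B : Matrix n n ℝ), (∀ i j, 0 ≤ B i j) ∧ (∀ i, ∑ j, B i j = r) ∧
      r ≤ ∑ i, ∑ j, A i j ∧ B.charpoly = A.charpoly := by
  obtain ⟨r, x, hx, hAx⟩ := exists_pos_eigenvector_of_pos A hA
  have hAx' : ∀ i, ∑ j, A i j * x j = r * x i := fun i => congrFun hAx i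
  have hs : 0 < ∑ i, x i := Finset.sum_pos (fun i _ => hx i) Finset.univ_nonempty
  -- This conjugation carries the Perron vector `x` to the all-ones vector.
  refine ⟨r, diagonal (fun i => (x i)⁻¹) * A * diagonal x, fun i j => ?_, fun i => ?_, ?_, ?_⟩
  · rw [mul_diagonal, diagonal_mul]
    exact mul_nonneg (mul_nonneg (inv_nonneg.mpr (hx i).le) (hA i j).le) (hx j).le
  · simp only [mul_diagonal, diagonal_mul, mul_assoc]
    rw [← Finset.mul_sum, hAx' i]
    field_simp [(hx i).ne']
  · refine le_of_mul_le_mul_right ?_ hs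
    rw [Finset.mul_sum, Finset.sum_mul]
    refine Finset.sum_le_sum fun i _ => ?_
    rw [← hAx' i, Finset.sum_mul]
    exact Finset.sum_le_sum fun j _ => mul_le_mul_of_nonneg_left
      (Finset.single_le_sum (fun k _ => (hx k).le) (Finset.mem_univ j)) (hA i j).le
  · rw [charpoly_mul_comm, ← Matrix.mul_assoc, diagonal_mul_diagonal]
    simp [fun i => mul_inv_cancel₀ (hx i).ne']

/-- A nonnegative matrix has the characteristic polynomial of a nonnegative matrix with constant
row sums. -/
theorem exists_constant_row_sums_of_nonneg [Nonempty n] (A : Matrix n n ℝ)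
    (hA : ∀ i j, 0 ≤ A i j) :
    ∃ (r : ℝ) (B : Matrix n n ℝ), (∀ i j, 0 ≤ B i j) ∧ (∀ i, ∑ j, B i j = r) ∧
      B.charpoly = A.charpoly := by
  obtain ⟨i₀⟩ := id ‹Nonempty n›
  let J : Matrix n n ℝ := of fun _ _ => 1
  let S : ℝ := ∑ i, ∑ j, (A i j + 1)
  let T : Set (n → n → ℝ) := Set.Icc (fun _ _ => 0) (fun _ _ => S) ∩
    {B | ∀ i, ∑ j, B i j = ∑ j, B i₀ j}
  have hT : IsCompact T := by
    refine isCompact_Icc.inter_right ?_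
    simp only [Set.ofPred_forall]
    exact isClosed_iInter fun i => isClosed_eq (by fun_prop) (by fun_prop)
  -- The characteristic polynomial as a function, with pointwise convergence. The conjugating
  -- vectors may degenerate as `ε → 0`, but the conjugates stay in the compact set `T`, so the image
  -- of `T` contains the limit.
  let φ : Matrix n n ℝ → ℝ → ℝ := fun B t => (scalar n t - B).det
  have hφ : Continuous φ := continuous_pi fun t =>
    (continuous_const.sub continuous_id).matrix_det
  have hφc : ∀ B B' : Matrix n n ℝ, φ B = φ B' ↔ B.charpoly = B'.charpoly := by
    refine fun B B' => ⟨fun h => Polynomial.funext fun t => ?_, fun h => funext fun t => ?_⟩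
    · simpa only [Matrix.eval_charpoly] using congrFun h t
    · simpa only [Matrix.eval_charpoly] using congrArg (eval t) h
  have hclosed : IsClosed (φ '' T) := (hT.image hφ).isClosed
  have hlim : Filter.Tendsto (fun ε : ℝ => φ (A + ε • J)) (𝓝[>] 0) (𝓝 (φ A)) := by
    have hc : Continuous fun ε : ℝ => φ (A + ε • J) := by fun_prop
    simpa using (hc.tendsto 0).mono_left nhdsWithin_le_nhds
  have hmem : φ A ∈ φ '' T := by
    refine hclosed.mem_of_tendsto hlim ?_
    filter_upwards [Ioc_mem_nhdsGT (zero_lt_one (α := ℝ))] with ε hε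
    obtain ⟨r, B, hB0, hBr, hrS, hBc⟩ := exists_constant_row_sums_of_pos (A + ε • J)
      (fun i j => by simpa [J] using add_pos_of_nonneg_of_pos (hA i j) hε.1)
    have hr : r ≤ S := hrS.trans <| Finset.sum_le_sum fun i _ => Finset.sum_le_sum fun j _ => by
      simpa [J] using hε.2
    refine ⟨B, ⟨⟨fun i j => hB0 i j, fun i j => ?_⟩, fun i => (hBr i).trans (hBr i₀).symm⟩,
      (hφc _ _).mpr hBc⟩
    exact (Finset.single_le_sum (fun k _ => hB0 i k) (Finset.mem_univ j)).trans
      ((hBr i).le.trans hr)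
  obtain ⟨B, ⟨⟨hB0, -⟩, hBr⟩, hB⟩ := hmem
  exact ⟨∑ j, B i₀ j, B, fun i j => hB0 i j, hBr, (hφc _ _).mp hB⟩

theorem isRoot_charpoly_of_mem_spec {A : Matrix n n ℝ} {r : ℝ} (h : (r : ℂ) ∈ spec A) :
    A.charpoly.IsRoot r := by
  have h1 := isRoot_of_mem_roots h
  have h2 : (A.map (fun x : ℝ => (x : ℂ))).charpoly = A.charpoly.map Complex.ofRealHom :=
    A.charpoly_map Complex.ofRealHom
  rw [h2] at h1
  exact (Polynomial.isRoot_map_iff Complex.ofRealHom.injective).mp h1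

theorem spec_eq_roots_map (A : Matrix n n ℝ) :
    spec A = (A.charpoly.map Complex.ofRealHom).roots :=
  congrArg roots (A.charpoly_map Complex.ofRealHom)

theorem isRoot_charpoly_iff_exists_eigenvector {A : Matrix n n ℝ} {r : ℝ} :
    A.charpoly.IsRoot r ↔ ∃ v : n → ℝ, v ≠ 0 ∧ A *ᵥ v = r • v := by
  rw [Polynomial.IsRoot.def, Matrix.eval_charpoly, ← exists_mulVec_eq_zero_iff]
  refine exists_congr fun v => and_congr_right fun _ => ?_
  rw [Matrix.sub_mulVec, sub_eq_zero, eq_comm]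
  simp [funext_iff]

end Perron

/-! ### Realisable lists and the main construction -/

/-- A realisable list with Perron eigenvalue `ρ` is realised by a nonnegative matrix all of whose
row sums are `ρ`. -/
theorem Realisable.exists_row_sums_eq_perron {σ : Multiset ℂ} {ρ : ℝ} (h : Realisable σ)
    (hρ : IsPerronEigenvalue ρ σ) :
    ∃ (N : ℕ) (B : Matrix (Fin N) (Fin N) ℝ), Nonempty (Fin N) ∧ (∀ i j, 0 ≤ B i j) ∧
      (∀ i, ∑ j, B i j = ρ) ∧ spec B = σ := by
  obtain ⟨N, A, hA, rfl⟩ := h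
  have hN : Nonempty (Fin N) := by
    obtain ⟨v, hv, -⟩ := isRoot_charpoly_iff_exists_eigenvector.mp
      (isRoot_charpoly_of_mem_spec hρ.1)
    obtain ⟨i, -⟩ := Function.ne_iff.mp hv
    exact ⟨i⟩
  obtain ⟨r, B, hB, hr, hBA⟩ := exists_constant_row_sums_of_nonneg A hA
  have hspec : spec B = spec A := by rw [spec_eq_roots_map, spec_eq_roots_map, hBA]
  rw [← hspec] at hρ ⊢
  have hroot : B.charpoly.IsRoot r := isRoot_charpoly_iff_exists_eigenvector.mpr
    ⟨1, one_ne_zero, funext fun i => by simp [mulVec, dotProduct, hr i]⟩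
  have h1 : (r : ℂ) ∈ spec B := by
    rw [spec_eq_roots_map, mem_roots (B.charpoly_monic.map _).ne_zero]
    exact hroot.map
  obtain ⟨v, hv, hBv⟩ := isRoot_charpoly_iff_exists_eigenvector.mp
    (isRoot_charpoly_of_mem_spec hρ.1)
  have h2 : r ≤ ρ := (le_abs_self r).trans (by simpa using hρ.2 _ h1)
  have h3 : r = ρ := le_antisymm h2 (eigenvalue_le_row_sum hB hr hv hBv)
  exact ⟨N, B, hN, hB, fun i => (hr i).trans h3, rfl⟩

theorem realisable_spec_of_nonneg {ι : Type*} [Fintype ι] [DecidableEq ι] (B : Matrix ι ι ℝ)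
    (hB : ∀ i j, 0 ≤ B i j) : Realisable (spec B) := by
  refine ⟨Fintype.card ι, reindex (Fintype.equivFin ι) (Fintype.equivFin ι) B,
    fun i j => hB _ _, ?_⟩
  rw [spec_eq_roots_map, spec_eq_roots_map, charpoly_reindex]

theorem mainTheorem4
    (ρ lam₂ : ℝ) (tail : Multiset ℂ)
    (hreal : Realisable ((ρ : ℂ) ::ₘ (lam₂ : ℂ) ::ₘ tail))
    (hPerron : IsPerronEigenvalue ρ ((ρ : ℂ) ::ₘ (lam₂ : ℂ) ::ₘ tail))
    (hne : ρ ≠ lam₂)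
    (b₁ b₂ γ : ℝ)
    (hγ : γ = (ρ + lam₂ - b₁) / 2) (hγ0 : 0 ≤ γ)
    (hb₂ : b₂ = ((ρ - lam₂) ^ 2 - b₁ ^ 2) / 4)
    (C' : Matrix (Fin 2) (Fin 2) ℝ) (hC' : C' = !![γ, 1; b₂, b₁ + γ])
    (k : ℕ) (f g c d : Fin k → ℝ)
    (hg : ∀ i, 0 ≤ g i) (hf : ∀ i, (γ - lam₂) * g i ≤ f i)
    (K' : Matrix (Fin k) (Fin 2) ℝ) (hK' : K' = Matrix.of (fun i => ![f i, g i]))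
    (hc : ∀ i, 0 ≤ c i) (hd : ∀ i, (ρ - γ) * c i ≤ d i)
    (L' : Matrix (Fin 2) (Fin k) ℝ) (hL' : L' = Matrix.of ![c, d])
    (A : Matrix (Fin k) (Fin k) ℝ) (hA : ∀ i j, 0 ≤ A i j)
    (M' : Matrix (Fin k ⊕ Fin 2) (Fin k ⊕ Fin 2) ℝ) (hM' : M' = Matrix.fromBlocks A K' L' C') :
    Realisable (spec M' + tail) := by
  have hlt : lam₂ < ρ := lt_of_le_of_ne
    ((le_abs_self lam₂).trans (by simpa using hPerron.2 (lam₂ : ℂ) (by simp))) hne.symm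
  obtain ⟨N, B, hN, hB, hrow, hspec⟩ := hreal.exists_row_sums_eq_perron hPerron
  obtain ⟨v, hv, hBv⟩ := isRoot_charpoly_iff_exists_eigenvector.mp
    (isRoot_charpoly_of_mem_spec (A := B) (r := lam₂) (by simp [hspec]))
  obtain ⟨y, hBy, hy1, ⟨p, hp⟩, ⟨q, hq⟩⟩ := exists_normalized_eigenvector hB hrow hlt hv hBv
  have hδ : 0 < ρ - lam₂ := sub_pos.mpr hlt
  have hBy' : ∀ i, ∑ j, B i j * y j = lam₂ * y i := fun i => congrFun hBy i
  -- The columns of `U` span the invariant subspace of `B` on which it acts as `C'`.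
  let u₂ : Fin N → ℝ := fun i => (1 - y i) / (ρ - lam₂)
  let u₁ : Fin N → ℝ := fun i => y i + (γ - lam₂) * u₂ i
  -- `U` sends the eigenvectors `(1, ρ - γ)` and `(1, lam₂ - γ)` of `C'` to the all-ones vector and
  -- `y`.
  let U : Matrix (Fin N) (Fin 2) ℝ := of fun i => ![u₁ i, u₂ i]
  have hu₂ : ∀ i, 0 ≤ u₂ i := fun i => div_nonneg (sub_nonneg.mpr (hy1 i)) hδ.le
  have hyu : ∀ i, y i = 1 - (ρ - lam₂) * u₂ i := fun i => by
    simp only [u₂]; field_simp; ring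
  have hBu₂ : ∀ i, ∑ j, B i j * u₂ j = y i + ρ * u₂ i := by
    intro i
    have : ∑ j, B i j * u₂ j = (∑ j, B i j - ∑ j, B i j * y j) / (ρ - lam₂) := by
      rw [← Finset.sum_sub_distrib, Finset.sum_div]
      exact Finset.sum_congr rfl fun j _ => by simp only [u₂]; ring
    rw [this, hrow, hBy', div_eq_iff hδ.ne']
    have := hyu i
    linear_combination -ρ * this
  have hBu₁ : ∀ i, ∑ j, B i j * u₁ j = lam₂ * y i + (γ - lam₂) * (y i + ρ * u₂ i) := by
    intro i
    rw [← hBy' i, ← hBu₂ i, Finset.mul_sum, ← Finset.sum_add_distrib]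
    exact Finset.sum_congr rfl fun j _ => by simp only [u₁]; ring
  have hBU : B * U = U * C' := by
    subst hC'
    ext i j
    fin_cases j
    · simp [Matrix.mul_apply, U, Fin.sum_univ_two, hBu₁]
      simp only [u₁, hb₂, hγ]
      ring
    · simp [Matrix.mul_apply, U, Fin.sum_univ_two, hBu₂]
      simp only [u₁, hγ]
      ring
  have hL : ∀ i j, 0 ≤ (U * L') i j := by
    intro i j
    have : (U * L') i j = c j + u₂ i * (d j - (ρ - γ) * c j) := by
      simp [hL', Matrix.mul_apply, U, Fin.sum_univ_two, u₁, hyu]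
      ring
    rw [this]
    exact add_nonneg (hc j) (mul_nonneg (hu₂ i) (sub_nonneg.mpr (hd j)))
  -- Rows of `K` are supported on an index where `y` is `1` and one where `y` is nonpositive.
  have hq' : 0 < 1 - y q := by linarith
  -- Since `u₂ p = 0`, the weight at `q` alone must produce `g`; the weight at `p` is then forced by
  -- `f`, and is nonnegative because `y q ≤ 0`.
  let β : Fin k → ℝ := fun i => (ρ - lam₂) * g i / (1 - y q)
  have hβ : ∀ i, 0 ≤ β i := fun i => div_nonneg (mul_nonneg hδ.le (hg i)) hq'.le
  let K : Matrix (Fin k) (Fin N) ℝ := of fun i =>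
    Pi.single p (f i - (γ - lam₂) * g i - β i * y q) + Pi.single q (β i)
  have hK : ∀ i j, 0 ≤ K i j := by
    intro i j
    have hsingle : ∀ (s : Fin N) (a : ℝ), 0 ≤ a → 0 ≤ (Pi.single s a : Fin N → ℝ) :=
      fun s a ha => Pi.single_nonneg.mpr ha
    refine add_nonneg (hsingle p _ ?_ j) (hsingle q _ (hβ i) j)
    nlinarith [hf i, mul_nonneg (hβ i) (neg_nonneg.mpr hq)]
  have hKw : ∀ i (w : Fin N → ℝ), ∑ j, K i j * w j =
      (f i - (γ - lam₂) * g i - β i * y q) * w p + β i * w q := by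
    intro i w
    simp [K, add_mul, Finset.sum_add_distrib, Pi.single_apply]
  have hu₂p : u₂ p = 0 := by simp [u₂, hp]
  have hβu : ∀ i, β i * u₂ q = g i := fun i => by
    simp only [β, u₂]; field_simp
  have hKU : K * U = K' := by
    subst hK'
    ext i j
    fin_cases j
    · simp [Matrix.mul_apply, U, hKw, u₁, hu₂p, hp]
      linear_combination (γ - lam₂) * hβu i
    · simp [Matrix.mul_apply, U, hKw, hu₂p, hβu]
  have hchar := charpoly_fromBlocks_mul_charpoly_of_intertwine A K L' B C' U hBU
  rw [hKU, ← hM'] at hchar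
  have hCroots : spec C' = {(ρ : ℂ), (lam₂ : ℂ)} := by
    have : C'.charpoly = (X - Polynomial.C ρ) * (X - Polynomial.C lam₂) := by
      refine Polynomial.funext fun t => ?_
      simp [Matrix.eval_charpoly, hC', Matrix.det_fin_two, hγ, hb₂]
      ring
    rw [spec_eq_roots_map, this, Polynomial.map_mul, roots_mul]
    · simp
    · exact (((monic_X_sub_C ρ).map _).mul ((monic_X_sub_C lam₂).map _)).ne_zero
  set M := fromBlocks A K (U * L') B with hM
  have hsum : spec M + spec C' = spec M' + spec B := by
    simp only [spec_eq_roots_map]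
    rw [← roots_mul, ← roots_mul, ← Polynomial.map_mul, ← Polynomial.map_mul, hchar]
    · exact ((M'.charpoly_monic.map _).mul (B.charpoly_monic.map _)).ne_zero
    · exact ((M.charpoly_monic.map _).mul (C'.charpoly_monic.map _)).ne_zero
  have hspecM : spec M = spec M' + tail := by
    refine add_right_cancel (b := ({(ρ : ℂ), (lam₂ : ℂ)} : Multiset ℂ)) ?_
    rw [← hCroots, hsum, hCroots, hspec, add_assoc, add_comm tail]
    simp
  rw [← hspecM]
  refine realisable_spec_of_nonneg M ?_
  rintro (i | i) (j | j)
  · exact hA i j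
  · exact hK i j
  · exact hL i j
  · exact hB i j
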